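/- Let $\mathcal H=\bigotimes_{i=1}^m\mathcal H_i$ be a multipartite quantum system with $\mathcal H_i=\mathbb C^{d_i}$. A *product state* is a vector $\varphi_1\otimes\dots\otimes\varphi_m$ with unit vectors $\varphi_i\in\mathcal H_i$. An *unextendible product basis* (UPB) is a set $S\subset\mathcal H$ of mutually orthogonal product states whose span is a proper subspace of $\mathcal H$ and such that the orthogonal complement of this span contains no product state. A *protocol of local POVMs with classical communication* consists of finitely many rounds. In each round one party $i$, chosen depending on all earlier outcomes, performs on its own system a measurement with finitely many outcomes $a$, given by measurement operators $A_a$ from its current space to some finite-dimensional space with $\sum_a A_a^\dagger A_a=\mathbf 1$ (so that the operators $A_a^\dagger A_a$ form a POVM), and announces the outcome to all parties. The other parties may then apply local isometries depending on $a$. Outcome $a$ turns the (unnormalized) state $v$ into the state obtained by applying these local operators. At the end, depending on all outcomes, the parties announce a member of $S$. The protocol *perfectly distinguishes* the members of $S$ if, for every $\psi\in S$, when it is run on the state $\psi$ it announces $\psi$ with probability $1$. **Theorem.** If $S$ is a UPB in $\mathcal H$, then no protocol of local POVMs with classical communication perfectly distinguishes the members of $S$. -/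

import Mathlib

open scoped Matrix

noncomputable section

/-- The Hilbert space `⨂ⱼ ℂ^(d j)` of an `m`-partite quantum system with local dimensions `d j`,
written in the standard product basis, which is indexed by the multi-indices `x = (x j)ⱼ`. -/
abbrev MultipartiteSpace {m : ℕ} (d : Fin m → ℕ) : Type :=
  EuclideanSpace ℂ (∀ j, Fin (d j))

/-- The product vector `⨂ⱼ φ j`. -/
def productVector {m : ℕ} {d : Fin m → ℕ} (φ : ∀ j, EuclideanSpace ℂ (Fin (d j))) :
    MultipartiteSpace d :=
  WithLp.toLp 2 fun x => ∏ j, φ j (x j)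

/-- A pure product state: the tensor product of a unit vector of each party. -/
def IsProductState {m : ℕ} {d : Fin m → ℕ} (v : MultipartiteSpace d) : Prop :=
  ∃ φ : ∀ j, EuclideanSpace ℂ (Fin (d j)), (∀ j, ‖φ j‖ = 1) ∧ v = productVector φ

/-- An (incomplete orthogonal) product basis: a set of mutually orthogonal pure product states
that spans a proper subspace. -/
structure IsProductBasis {m : ℕ} {d : Fin m → ℕ} (S : Set (MultipartiteSpace d)) : Prop where
  productState : ∀ ψ ∈ S, IsProductState ψ
  orthogonal : ∀ ψ ∈ S, ∀ χ ∈ S, ψ ≠ χ → inner ℂ ψ χ = 0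
  proper : Submodule.span ℂ S ≠ ⊤

/-- An unextendible product basis: a product basis such that the orthogonal complement of its span
contains no product state. -/
structure IsUPB {m : ℕ} {d : Fin m → ℕ} (S : Set (MultipartiteSpace d)) : Prop
    extends IsProductBasis S where
  unextendible : ∀ v ∈ (Submodule.span ℂ S)ᗮ, ¬ IsProductState v

/-- The matrix of `⨂ⱼ A j`, where `A j` acts on the space of party `j`. -/
def productOperator {m : ℕ} {d e : Fin m → ℕ} (A : ∀ j, Matrix (Fin (e j)) (Fin (d j)) ℂ) :
    Matrix (∀ j, Fin (e j)) (∀ j, Fin (d j)) ℂ :=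
  Matrix.of fun x y => ∏ j, A j (x j) (y j)

/-- The (unnormalized) state vector `(⨂ⱼ A j) v`. -/
def applyLocal {m : ℕ} {d e : Fin m → ℕ} (A : ∀ j, Matrix (Fin (e j)) (Fin (d j)) ℂ)
    (v : MultipartiteSpace d) : MultipartiteSpace e :=
  WithLp.toLp 2 (productOperator A *ᵥ v.ofLp)

/-- A protocol of local POVMs with classical communication on a system with local dimensions `d`,
ending with the announcement of an element of `Ω`.

The protocol is a finite tree. It either stops and announces an element of `Ω`, or some party `i`
performs a POVM with finitely many outcomes `a` and announces the outcome. The measurement operator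
of outcome `a` is `A a i`, so that the POVM elements are `(A a i)ᴴ * A a i`. Every other party `j`
may react by a local isometry `A a j` (for instance the identity, a unitary, or the adjunction of
an ancilla), and everything that follows may depend on `a`. The local dimensions `e a` after the
round are arbitrary. Random choices are POVMs whose measurement operators are multiples of the
identity, and information is forgotten by continuing in the same way after several outcomes. -/
inductive LOCCProtocol {m : ℕ} (Ω : Type) : (Fin m → ℕ) → Type
  | announce {d : Fin m → ℕ} (ω : Ω) : LOCCProtocol Ω d
  | round {d : Fin m → ℕ} (i : Fin m) (k : ℕ) (e : Fin k → Fin m → ℕ)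
      (A : ∀ (a : Fin k) (j : Fin m), Matrix (Fin (e a j)) (Fin (d j)) ℂ)
      (povm : ∑ a, (A a i)ᴴ * A a i = 1)
      (isometry : ∀ a j, j ≠ i → (A a j)ᴴ * A a j = 1)
      (next : ∀ a, LOCCProtocol Ω (e a)) : LOCCProtocol Ω d

open Classical in
/-- The probability that the protocol announces `ω` when it is run on the unit vector `v`. For a
general `v` it is `‖v‖ ^ 2` times the probability for the normalized vector. By the Born rule,
`‖applyLocal (A a) v‖ ^ 2` is the probability of the outcome `a`. -/
def LOCCProtocol.prob {m : ℕ} {Ω : Type} :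
    {d : Fin m → ℕ} → LOCCProtocol Ω d → MultipartiteSpace d → Ω → ℝ
  | _, .announce ω', v, ω => if ω' = ω then ‖v‖ ^ 2 else 0
  | _, .round _ _ _ A _ _ next, v, ω => ∑ a, (next a).prob (applyLocal (A a) v) ω

/-- The members of `S` are perfectly distinguishable by local POVMs and classical communication:
some protocol identifies an unknown member of `S` with probability one. -/
def LOCCDistinguishable {m : ℕ} {d : Fin m → ℕ} (S : Set (MultipartiteSpace d)) : Prop :=
  ∃ P : LOCCProtocol S d, ∀ ψ : S, P.prob (ψ : MultipartiteSpace d) ψ = 1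

end

/-!
The induction runs down one branch of the protocol. The parties' measurement operators so far
compose to local maps `B j`, and there are local subspaces `W j` on which `B j` multiplies all inner
products by a nonzero constant, such that every member of `S` either has all its factors in the
`W j` or has a factor orthogonal to `W j`. When party `i` applies a further measurement operator,
the states still in play must stay orthogonal. Unextendibility, applied to a member of `S` with its
`i`-th factor modified, then forces that factor to be an eigenvector of the Gram operator of the
composed measurement on `W i`. Hence each eigenspace with nonzero eigenvalue is a legitimate new
`W i`, and by completeness of the POVM these eigenspaces, over all outcomes, span the old `W i`. At
a leaf at most one member of `S` is left in the `W j`, and unextendibility puts `⨂ⱼ W j` into the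
span of `S`. Going back to the root, where `W j` is everything, `S` spans the whole space.
-/

section ConformalMaps

variable {𝕜 E F : Type*} [RCLike 𝕜] [NormedAddCommGroup E] [InnerProductSpace 𝕜 E]
  [NormedAddCommGroup F] [InnerProductSpace 𝕜 F]

/-- The linear map `B` is conformal on the subspace `W`: it multiplies the inner products of vectors
of `W` by a nonzero constant. A branch of a protocol acts like this on the surviving states. -/
def IsConformalOn (B : E →ₗ[𝕜] F) (W : Submodule 𝕜 E) : Prop :=
  ∃ c : 𝕜, c ≠ 0 ∧ ∀ x ∈ W, ∀ y ∈ W, inner 𝕜 (B x) (B y) = c * inner 𝕜 x y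

theorem isConformalOn_id (W : Submodule 𝕜 E) : IsConformalOn LinearMap.id W :=
  ⟨1, one_ne_zero, fun x _ y _ => by simp⟩

namespace IsConformalOn

variable {B : E →ₗ[𝕜] F} {W : Submodule 𝕜 E}

theorem inner_map_eq_zero_iff (hB : IsConformalOn B W) {x y : E} (hx : x ∈ W) (hy : y ∈ W) :
    inner 𝕜 (B x) (B y) = 0 ↔ inner 𝕜 x y = 0 := by
  obtain ⟨c, hc, h⟩ := hB
  rw [h x hx y hy, mul_eq_zero_iff_left hc]

theorem map_eq_zero_iff (hB : IsConformalOn B W) {x : E} (hx : x ∈ W) : B x = 0 ↔ x = 0 := by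
  rw [← inner_self_eq_zero (𝕜 := 𝕜), hB.inner_map_eq_zero_iff hx hx, inner_self_eq_zero]

theorem isometry_comp {G : Type*} [NormedAddCommGroup G] [InnerProductSpace 𝕜 G]
    (hB : IsConformalOn B W) {A : F →ₗ[𝕜] G}
    (hA : ∀ x y, inner 𝕜 (A x) (A y) = inner 𝕜 x y) : IsConformalOn (A ∘ₗ B) W := by
  obtain ⟨c, hc, h⟩ := hB
  exact ⟨c, hc, fun x hx y hy => (hA _ _).trans (h x hx y hy)⟩

end IsConformalOn

end ConformalMaps

section GramOperators

variable {𝕜 E F : Type*} [RCLike 𝕜] [NormedAddCommGroup E] [InnerProductSpace 𝕜 E]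
  [FiniteDimensional 𝕜 E] [NormedAddCommGroup F] [InnerProductSpace 𝕜 F] [FiniteDimensional 𝕜 F]

theorem range_le_of_forall_eigenspace_le {T : E →ₗ[𝕜] E} (hT : T.IsSymmetric)
    {L : Submodule 𝕜 E} (h : ∀ μ : 𝕜, μ ≠ 0 → Module.End.eigenspace T μ ≤ L) :
    LinearMap.range T ≤ L := by
  have hsup : ⨆ μ, Module.End.eigenspace T μ = ⊤ :=
    Submodule.orthogonal_eq_bot_iff.1 hT.orthogonalComplement_iSup_eigenspaces_eq_bot
  rw [LinearMap.range_eq_map, Submodule.map_le_iff_le_comap, ← hsup]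
  refine iSup_le fun μ v hv => ?_
  rw [Submodule.mem_comap, Module.End.mem_eigenspace_iff.1 hv]
  rcases eq_or_ne μ 0 with rfl | hμ
  · simp
  · exact L.smul_mem μ (h μ hμ hv)

/-- The Gram operator of `B` on the subspace `W`: the positive operator on `W` which represents the
form `⟪B x, B y⟫`, that is, the compression of `B† B` to `W`. -/
noncomputable def gramOn (B : E →ₗ[𝕜] F) (W : Submodule 𝕜 E) : W →ₗ[𝕜] W :=
  (B.domRestrict W).adjoint ∘ₗ B.domRestrict W

theorem inner_gramOn (B : E →ₗ[𝕜] F) (W : Submodule 𝕜 E) (x y : W) :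
    inner 𝕜 x (gramOn B W y) = inner 𝕜 (B x) (B y) :=
  (B.domRestrict W).adjoint_inner_right x (B y)

theorem isSymmetric_gramOn (B : E →ₗ[𝕜] F) (W : Submodule 𝕜 E) : (gramOn B W).IsSymmetric :=
  (B.domRestrict W).isSymmetric_adjoint_comp_self

/-- The eigenspace of the Gram operator of `B` on `W`, as a subspace of the ambient space. It is the
new local subspace of the measuring party. -/
noncomputable def gramEigenspace (B : E →ₗ[𝕜] F) (W : Submodule 𝕜 E) (μ : 𝕜) : Submodule 𝕜 E :=
  (Module.End.eigenspace (gramOn B W) μ).map W.subtype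

variable {B : E →ₗ[𝕜] F} {W : Submodule 𝕜 E} {μ : 𝕜}

theorem gramEigenspace_le : gramEigenspace B W μ ≤ W :=
  Submodule.map_subtype_le W _

theorem isConformalOn_gramEigenspace (hμ : μ ≠ 0) : IsConformalOn B (gramEigenspace B W μ) := by
  refine ⟨μ, hμ, ?_⟩
  rintro _ ⟨x, -, rfl⟩ _ ⟨y, hy, rfl⟩
  calc inner 𝕜 (B x) (B y) = inner 𝕜 x (gramOn B W y) := (inner_gramOn B W x y).symm
    _ = μ * inner 𝕜 x y := by rw [Module.End.mem_eigenspace_iff.1 hy, inner_smul_right]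

theorem mem_gramEigenspace_or_mem_orthogonal {x : E} (hxW : x ∈ W)
    (hx : (gramOn B W ⟨x, hxW⟩ : E) ∈ Submodule.span 𝕜 {x}) :
    x ∈ gramEigenspace B W μ ∨ x ∈ (gramEigenspace B W μ)ᗮ := by
  obtain ⟨ν, hν⟩ := Submodule.mem_span_singleton.1 hx
  have hxν : ⟨x, hxW⟩ ∈ Module.End.eigenspace (gramOn B W) ν :=
    Module.End.mem_eigenspace_iff.2 (Subtype.ext hν.symm)
  rcases eq_or_ne μ ν with rfl | hne
  · exact Or.inl ⟨⟨x, hxW⟩, hxν, rfl⟩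
  · right
    rintro _ ⟨y, hy, rfl⟩
    exact (isSymmetric_gramOn B W).orthogonalFamily_eigenspaces hne ⟨y, hy⟩ ⟨_, hxν⟩

end GramOperators

section Resolution

variable {𝕜 E F κ : Type*} [RCLike 𝕜] [NormedAddCommGroup E] [InnerProductSpace 𝕜 E]
  [FiniteDimensional 𝕜 E] [NormedAddCommGroup F] [InnerProductSpace 𝕜 F] [Fintype κ]
  {G : κ → Type*} [∀ a, NormedAddCommGroup (G a)] [∀ a, InnerProductSpace 𝕜 (G a)]
  [∀ a, FiniteDimensional 𝕜 (G a)] {W : Submodule 𝕜 E}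

theorem sum_gramOn_apply {M : ∀ a, E →ₗ[𝕜] G a} {c : 𝕜}
    (hM : ∀ x ∈ W, ∀ y ∈ W, ∑ a, inner 𝕜 (M a x) (M a y) = c * inner 𝕜 x y) (y : W) :
    ∑ a, gramOn (M a) W y = c • y := by
  refine ext_inner_left 𝕜 fun x => ?_
  simp_rw [inner_sum, inner_gramOn, inner_smul_right]
  exact hM x x.2 y y.2

theorem le_of_forall_gramEigenspace_le {B : E →ₗ[𝕜] F} {M : ∀ a, F →ₗ[𝕜] G a}
    (hM : ∀ x y, ∑ a, inner 𝕜 (M a x) (M a y) = inner 𝕜 x y) (hB : IsConformalOn B W)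
    {L : Submodule 𝕜 E} (h : ∀ a, ∀ μ : 𝕜, μ ≠ 0 → gramEigenspace (M a ∘ₗ B) W μ ≤ L) :
    W ≤ L := by
  obtain ⟨c, hc, hBc⟩ := hB
  intro x hx
  have hsum : ∑ a, gramOn (M a ∘ₗ B) W ⟨x, hx⟩ = c • (⟨x, hx⟩ : W) :=
    sum_gramOn_apply (M := fun a => M a ∘ₗ B)
      (fun y hy z hz => (hM (B y) (B z)).trans (hBc y hy z hz)) _
  have hrange : ∀ a, LinearMap.range (gramOn (M a ∘ₗ B) W) ≤ L.comap W.subtype := fun a =>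
    range_le_of_forall_eigenspace_le (isSymmetric_gramOn _ W) fun μ hμ =>
      Submodule.map_le_iff_le_comap.1 (h a μ hμ)
  have hmem : c • (⟨x, hx⟩ : W) ∈ L.comap W.subtype :=
    hsum ▸ Submodule.sum_mem _ fun a _ => hrange a (LinearMap.mem_range_self _ _)
  exact (Submodule.smul_mem_iff _ hc).1 hmem

end Resolution

section Unextendible

variable {𝕜 ι κ : Type*} [RCLike 𝕜] {H : κ → Type*} [∀ j, NormedAddCommGroup (H j)]
  [∀ j, InnerProductSpace 𝕜 (H j)]

variable (𝕜) in
/-- Unextendibility of the product vectors `⨂ⱼ φ x j`, in terms of their factors: product vectors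
are orthogonal exactly if some pair of corresponding factors is. -/
def IsUnextendible (φ : ι → ∀ j, H j) : Prop :=
  ∀ u : ∀ j, H j, (∀ j, u j ≠ 0) → ∃ x, ∀ j, inner 𝕜 (φ x j) (u j) ≠ 0

/-- Every product vector `⨂ⱼ φ x j` visibly lies in the product subspace `⨂ⱼ W j` or in its
orthogonal complement: the former if all its factors lie in the `W j`, the latter if some factor is
orthogonal to `W j`. -/
def IsSplitBy (φ : ι → ∀ j, H j) (W : ∀ j, Submodule 𝕜 (H j)) : Prop :=
  ∀ x, (∀ j, φ x j ∈ W j) ∨ ∃ j, φ x j ∈ (W j)ᗮ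

variable {φ : ι → ∀ j, H j} {W : ∀ j, Submodule 𝕜 (H j)}

theorem IsSplitBy.update [DecidableEq κ] (hW : IsSplitBy φ W) {i : κ} {V : Submodule 𝕜 (H i)}
    (hVW : V ≤ W i) (hV : ∀ x, (∀ j, φ x j ∈ W j) → φ x i ∈ V ∨ φ x i ∈ Vᗮ) :
    IsSplitBy φ (Function.update W i V) := by
  intro x
  rcases hW x with hx | ⟨j, hj⟩
  · rcases hV x hx with hxV | hxV
    · exact Or.inl <| (Function.forall_update_iff W fun j U => φ x j ∈ U).2 ⟨hxV, fun j _ => hx j⟩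
    · exact Or.inr ⟨i, by rwa [Function.update_self]⟩
  · have hle : Function.update W i V ≤ W := update_le_self_iff.2 hVW
    exact Or.inr ⟨j, Submodule.orthogonal_le (hle j) hj⟩

namespace IsUnextendible

theorem exists_mem_inner_ne_zero (hφ : IsUnextendible 𝕜 φ) (hW : IsSplitBy φ W) {u : ∀ j, H j}
    (hu : ∀ j, u j ∈ W j) (hu0 : ∀ j, u j ≠ 0) :
    ∃ x, (∀ j, φ x j ∈ W j) ∧ ∀ j, inner 𝕜 (φ x j) (u j) ≠ 0 := by
  obtain ⟨x, hx⟩ := hφ u hu0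
  refine ⟨x, (hW x).resolve_right ?_, hx⟩
  rintro ⟨j, hj⟩
  exact hx j (Submodule.inner_left_of_mem_orthogonal (hu j) hj)

theorem mem_span_singleton_of_update [DecidableEq κ] (hφ : IsUnextendible 𝕜 φ)
    (hW : IsSplitBy φ W) {x : ι} (hx0 : ∀ j, φ x j ≠ 0) (hx : ∀ j, φ x j ∈ W j)
    (horth : ∀ y, y ≠ x → (∀ j, φ y j ∈ W j) → ∃ j, inner 𝕜 (φ y j) (φ x j) = 0)
    {i : κ} {w : H i} (hw : w ∈ W i)
    (hworth : ∀ y, y ≠ x → (∀ j, φ y j ∈ W j) →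
      ∃ j, inner 𝕜 (φ y j) (Function.update (φ x) i w j) = 0) :
    w ∈ Submodule.span 𝕜 {φ x i} := by
  obtain ⟨p, hp, r, hr, rfl⟩ := (Submodule.span 𝕜 {φ x i}).exists_add_mem_mem_orthogonal w
  suffices hr0 : r = 0 by rwa [hr0, add_zero]
  obtain ⟨c, rfl⟩ := Submodule.mem_span_singleton.1 hp
  by_contra hr0
  have hrW : r ∈ W i := by simpa using (W i).sub_mem hw ((W i).smul_mem c (hx i))
  obtain ⟨y, hy, hyr⟩ := hφ.exists_mem_inner_ne_zero hW (u := Function.update (φ x) i r)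
    ((Function.forall_update_iff (φ x) fun j v => v ∈ W j).2 ⟨hrW, fun j _ => hx j⟩)
    ((Function.forall_update_iff (φ x) fun _ v => v ≠ 0).2 ⟨hr0, fun j _ => hx0 j⟩)
  obtain ⟨hyri, hyrj⟩ :=
    (Function.forall_update_iff (φ x) fun j v => inner 𝕜 (φ y j) v ≠ 0).1 hyr
  have hyx : y ≠ x := by
    rintro rfl
    exact hyri (Submodule.inner_right_of_mem_orthogonal (Submodule.mem_span_singleton_self _) hr)
  have hφi : inner 𝕜 (φ y i) (φ x i) = 0 := by
    obtain ⟨j, hj⟩ := horth y hyx hy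
    by_cases hji : j = i
    · exact hji ▸ hj
    · exact absurd hj (hyrj j hji)
  obtain ⟨j, hj⟩ := hworth y hyx hy
  rcases eq_or_ne j i with rfl | hji
  · rw [Function.update_self, inner_add_right, inner_smul_right, hφi, mul_zero, zero_add] at hj
    exact hyri hj
  · rw [Function.update_of_ne hji] at hj
    exact hyrj j hji hj

theorem map_mem_span_of_subsingleton [Finite κ] {G : Type*} [AddCommGroup G] [Module 𝕜 G]
    (f : MultilinearMap 𝕜 H G) (hφ : IsUnextendible 𝕜 φ) (hφ0 : ∀ x j, φ x j ≠ 0)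
    (hW : IsSplitBy φ W) {z : ι} (hz : ∀ x, (∀ j, φ x j ∈ W j) → x = z) {u : ∀ j, H j}
    (hu : ∀ j, u j ∈ W j) : f u ∈ Submodule.span 𝕜 (Set.range fun x => f (φ x)) := by
  classical
  cases nonempty_fintype κ
  by_cases hzW : ∀ j, φ z j ∈ W j
  · have hspan : ∀ j, ∃ c : 𝕜, c • φ z j = u j := fun j =>
      Submodule.mem_span_singleton.1 <| hφ.mem_span_singleton_of_update hW (hφ0 z) hzW
        (fun y hyz hy => absurd (hz y hy) hyz) (hu j) fun y hyz hy => absurd (hz y hy) hyz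
    choose c hc using hspan
    rw [← funext hc, f.map_smul_univ]
    exact Submodule.smul_mem _ _ (Submodule.subset_span ⟨z, rfl⟩)
  · obtain ⟨j, hj⟩ : ∃ j, u j = 0 := by
      by_contra! hu0
      obtain ⟨x, hx, -⟩ := hφ.exists_mem_inner_ne_zero hW hu hu0
      exact hzW (hz x hx ▸ hx)
    rw [f.map_coord_zero j hj]
    exact Submodule.zero_mem _

end IsUnextendible

end Unextendible

section ProductVectors

variable {m : ℕ} {d : Fin m → ℕ}

theorem inner_productVector (φ χ : ∀ j, EuclideanSpace ℂ (Fin (d j))) :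
    inner ℂ (productVector φ) (productVector χ) = ∏ j, inner ℂ (φ j) (χ j) := by
  simp only [productVector, PiLp.inner_apply, RCLike.inner_apply, map_prod,
    ← Finset.prod_mul_distrib]
  exact (Fintype.prod_sum fun j (x : Fin (d j)) => χ j x * (starRingEnd ℂ) (φ j x)).symm

theorem inner_productVector_eq_zero_iff {φ χ : ∀ j, EuclideanSpace ℂ (Fin (d j))} :
    inner ℂ (productVector φ) (productVector χ) = 0 ↔ ∃ j, inner ℂ (φ j) (χ j) = 0 := by
  simp only [inner_productVector, Finset.prod_eq_zero_iff, Finset.mem_univ, true_and]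

theorem productVector_eq_zero_iff {φ : ∀ j, EuclideanSpace ℂ (Fin (d j))} :
    productVector φ = 0 ↔ ∃ j, φ j = 0 := by
  rw [← inner_self_eq_zero (𝕜 := ℂ), inner_productVector_eq_zero_iff]
  simp only [inner_self_eq_zero]

theorem IsProductState.norm_eq_one {v : MultipartiteSpace d} (hv : IsProductState v) :
    ‖v‖ = 1 := by
  obtain ⟨φ, hφ, rfl⟩ := hv
  have h := inner_productVector φ φ
  simp_rw [inner_self_eq_norm_sq_to_K, hφ, RCLike.ofReal_one, one_pow, Finset.prod_const_one] at h
  exact (pow_eq_one_iff_of_nonneg (norm_nonneg _) two_ne_zero).1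
    (RCLike.ofReal_injective (K := ℂ) (by rwa [RCLike.ofReal_pow, RCLike.ofReal_one]))

/-- The product vector as a multilinear function of its factors. -/
noncomputable def productVectorMultilinear (d : Fin m → ℕ) :
    MultilinearMap ℂ (fun j => EuclideanSpace ℂ (Fin (d j))) (MultipartiteSpace d) :=
  (WithLp.linearEquiv 2 ℂ _).symm.toLinearMap.compMultilinearMap <|
    MultilinearMap.pi fun x => (MultilinearMap.mkPiAlgebra ℂ (Fin m) ℂ).compLinearMap fun j =>
      (EuclideanSpace.proj (x j)).toLinearMap

theorem productVectorMultilinear_apply (φ : ∀ j, EuclideanSpace ℂ (Fin (d j))) :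
    productVectorMultilinear d φ = productVector φ := rfl

theorem span_range_productVector (d : Fin m → ℕ) :
    Submodule.span ℂ (Set.range (productVector (d := d))) = ⊤ := by
  rw [eq_top_iff, ← (EuclideanSpace.basisFun (∀ j, Fin (d j)) ℂ).toBasis.span_eq]
  refine Submodule.span_mono ?_
  rintro _ ⟨x, rfl⟩
  refine ⟨fun j => EuclideanSpace.single (x j) 1, ?_⟩
  ext y
  simp [productVector, Finset.prod_ite_zero, funext_iff]

theorem isUnextendible_of_forall_not_isProductState {ι : Type*}
    {φ : ι → ∀ j, EuclideanSpace ℂ (Fin (d j))}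
    (h : ∀ v ∈ (Submodule.span ℂ (Set.range fun x => productVector (φ x)))ᗮ,
      ¬ IsProductState v) : IsUnextendible ℂ φ := by
  intro u hu
  by_contra! hux
  refine h _ ?_ ⟨fun j => (‖u j‖ : ℂ)⁻¹ • u j, fun j => norm_smul_inv_norm (hu j), rfl⟩
  rw [← Submodule.span_singleton_le_iff_mem, ← Submodule.isOrtho_iff_le, Submodule.isOrtho_comm,
    Submodule.isOrtho_span]
  rintro _ ⟨x, rfl⟩ _ rfl
  obtain ⟨j, hj⟩ := hux x
  exact inner_productVector_eq_zero_iff.2 ⟨j, by rw [inner_smul_right, hj, mul_zero]⟩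

end ProductVectors

section LocalOperators

section Matrices

variable {𝕜 n p : Type*} [RCLike 𝕜] [Fintype n] [DecidableEq n] [Fintype p]

theorem inner_toEuclideanLin_toEuclideanLin (A B : Matrix p n 𝕜) (x y : EuclideanSpace 𝕜 n) :
    inner 𝕜 (Matrix.toEuclideanLin A x) (Matrix.toEuclideanLin B y) =
      inner 𝕜 x (Matrix.toEuclideanLin (Aᴴ * B) y) := by
  classical
  rw [← LinearMap.adjoint_inner_right, ← Matrix.toEuclideanLin_conjTranspose_eq_adjoint]
  simp [Matrix.toLpLin_apply, Matrix.mulVec_mulVec]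

theorem inner_toEuclideanLin_of_isometry {A : Matrix p n 𝕜} (hA : Aᴴ * A = 1)
    (x y : EuclideanSpace 𝕜 n) :
    inner 𝕜 (Matrix.toEuclideanLin A x) (Matrix.toEuclideanLin A y) = inner 𝕜 x y := by
  rw [inner_toEuclideanLin_toEuclideanLin, hA]
  simp

theorem sum_inner_toEuclideanLin_of_povm {κ : Type*} [Fintype κ] {l : κ → Type*}
    [∀ a, Fintype (l a)] {A : ∀ a, Matrix (l a) n 𝕜} (hA : ∑ a, (A a)ᴴ * A a = 1)
    (x y : EuclideanSpace 𝕜 n) :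
    ∑ a, inner 𝕜 (Matrix.toEuclideanLin (A a) x) (Matrix.toEuclideanLin (A a) y) =
      inner 𝕜 x y := by
  simp_rw [inner_toEuclideanLin_toEuclideanLin]
  rw [← inner_sum, ← LinearMap.sum_apply, ← map_sum, hA]
  simp

end Matrices

variable {m : ℕ} {d e : Fin m → ℕ}

theorem applyLocal_eq_toEuclideanLin (A : ∀ j, Matrix (Fin (e j)) (Fin (d j)) ℂ)
    (v : MultipartiteSpace d) : applyLocal A v = Matrix.toEuclideanLin (productOperator A) v := rfl

theorem applyLocal_productVector (A : ∀ j, Matrix (Fin (e j)) (Fin (d j)) ℂ)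
    (φ : ∀ j, EuclideanSpace ℂ (Fin (d j))) :
    applyLocal A (productVector φ) =
      productVector fun j => Matrix.toEuclideanLin (A j) (φ j) := by
  ext x
  simp only [applyLocal, productVector, productOperator, Matrix.mulVec, dotProduct,
    Matrix.of_apply, Matrix.toLpLin_apply, ← Finset.prod_mul_distrib]
  exact (Fintype.prod_sum fun j (y : Fin (d j)) => A j (x j) y * φ j y).symm

theorem conjTranspose_productOperator_mul_self (A : ∀ j, Matrix (Fin (e j)) (Fin (d j)) ℂ) :
    (productOperator A)ᴴ * productOperator A = productOperator fun j => (A j)ᴴ * A j := by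
  ext x y
  simp only [productOperator, Matrix.mul_apply, Matrix.conjTranspose_apply, Matrix.of_apply,
    star_prod, ← Finset.prod_mul_distrib]
  exact (Fintype.prod_sum fun j (z : Fin (e j)) => star (A j z (x j)) * A j z (y j)).symm

theorem sum_productOperator_eq_one {κ : Type*} [Fintype κ] {i : Fin m}
    {N : κ → ∀ j, Matrix (Fin (d j)) (Fin (d j)) ℂ} (hi : ∑ a, N a i = 1)
    (hj : ∀ a j, j ≠ i → N a j = 1) : ∑ a, productOperator (N a) = 1 := by
  have hsplit : ∀ a x y, productOperator (N a) x y =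
      N a i (x i) (y i) * ∏ j ∈ Finset.univ.erase i, (1 : Matrix _ _ ℂ) (x j) (y j) := by
    intro a x y
    rw [productOperator, Matrix.of_apply, ← Finset.mul_prod_erase _ _ (Finset.mem_univ i)]
    exact congrArg _ <| Finset.prod_congr rfl fun j h => by rw [hj a j (Finset.ne_of_mem_erase h)]
  ext x y
  simp_rw [Matrix.sum_apply, hsplit, ← Finset.sum_mul, ← Matrix.sum_apply, hi]
  rw [Finset.mul_prod_erase Finset.univ (fun j => (1 : Matrix _ _ ℂ) (x j) (y j))
    (Finset.mem_univ i)]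
  simp [Matrix.one_apply, Finset.prod_ite_zero, funext_iff]

end LocalOperators

namespace LOCCProtocol

section Round

variable {m k : ℕ} {d : Fin m → ℕ} {i : Fin m} {e : Fin k → Fin m → ℕ}
  {A : ∀ (a : Fin k) (j : Fin m), Matrix (Fin (e a j)) (Fin (d j)) ℂ}

theorem sum_inner_applyLocal (povm : ∑ a, (A a i)ᴴ * A a i = 1)
    (isometry : ∀ a j, j ≠ i → (A a j)ᴴ * A a j = 1) (v w : MultipartiteSpace d) :
    ∑ a, inner ℂ (applyLocal (A a) v) (applyLocal (A a) w) = inner ℂ v w := by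
  simp_rw [applyLocal_eq_toEuclideanLin]
  refine sum_inner_toEuclideanLin_of_povm ?_ v w
  simp_rw [conjTranspose_productOperator_mul_self]
  exact sum_productOperator_eq_one povm isometry

theorem sum_norm_sq_applyLocal (povm : ∑ a, (A a i)ᴴ * A a i = 1)
    (isometry : ∀ a j, j ≠ i → (A a j)ᴴ * A a j = 1) (v : MultipartiteSpace d) :
    ∑ a, ‖applyLocal (A a) v‖ ^ 2 = ‖v‖ ^ 2 := by
  have h := sum_inner_applyLocal povm isometry v v
  simp_rw [inner_self_eq_norm_sq_to_K] at h
  exact_mod_cast h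

end Round

variable {m : ℕ} {Ω : Type} {d : Fin m → ℕ}

/-- The protocol announces `ω` with certainty when it is run on `v`. As `v` need not be normalized,
the probabilities are relative to `‖v‖ ^ 2`, and the zero vector surely announces everything. -/
def SurelyAnnounces (P : LOCCProtocol Ω d) (v : MultipartiteSpace d) (ω : Ω) : Prop :=
  P.prob v ω = ‖v‖ ^ 2

theorem prob_le_norm_sq (P : LOCCProtocol Ω d) (v : MultipartiteSpace d) (ω : Ω) :
    P.prob v ω ≤ ‖v‖ ^ 2 := by
  induction P with
  | announce ω' =>
    rw [prob]
    split_ifs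
    · exact le_rfl
    · positivity
  | round i k e A povm isometry next ih =>
    rw [prob, ← sum_norm_sq_applyLocal povm isometry]
    exact Finset.sum_le_sum fun a _ => ih a _

theorem SurelyAnnounces.eq_zero_of_ne {ω ω' : Ω} {v : MultipartiteSpace d}
    (h : (announce ω' : LOCCProtocol Ω d).SurelyAnnounces v ω) (hne : ω ≠ ω') : v = 0 := by
  rw [SurelyAnnounces, prob, if_neg hne.symm] at h
  exact norm_eq_zero.1 (pow_eq_zero_iff two_ne_zero |>.1 h.symm)

theorem SurelyAnnounces.next {i : Fin m} {k : ℕ} {e : Fin k → Fin m → ℕ}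
    {A : ∀ (a : Fin k) (j : Fin m), Matrix (Fin (e a j)) (Fin (d j)) ℂ}
    {povm : ∑ a, (A a i)ᴴ * A a i = 1} {isometry : ∀ a j, j ≠ i → (A a j)ᴴ * A a j = 1}
    {next : ∀ a, LOCCProtocol Ω (e a)} {v : MultipartiteSpace d} {ω : Ω}
    (h : (round i k e A povm isometry next).SurelyAnnounces v ω) (a : Fin k) :
    (next a).SurelyAnnounces (applyLocal (A a) v) ω := by
  rw [SurelyAnnounces, prob, ← sum_norm_sq_applyLocal povm isometry] at h
  exact (Finset.sum_eq_sum_iff_of_le fun a _ => prob_le_norm_sq _ _ _).1 h a (Finset.mem_univ a)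

theorem SurelyAnnounces.inner_eq_zero {P : LOCCProtocol Ω d} {v w : MultipartiteSpace d}
    {ω η : Ω} (hv : P.SurelyAnnounces v ω) (hw : P.SurelyAnnounces w η) (hne : ω ≠ η) :
    inner ℂ v w = 0 := by
  induction P with
  | announce ω' =>
    by_cases h : ω = ω'
    · rw [hw.eq_zero_of_ne (h ▸ hne.symm), inner_zero_right]
    · rw [hv.eq_zero_of_ne h, inner_zero_left]
  | round i k e A povm isometry next ih =>
    rw [← sum_inner_applyLocal povm isometry]
    exact Finset.sum_eq_zero fun a _ => ih a (hv.next a) (hw.next a)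

end LOCCProtocol

section Branches

variable {m : ℕ} {ι : Type} {d₀ d : Fin m → ℕ} {φ : ι → ∀ j, EuclideanSpace ℂ (Fin (d₀ j))}
  {B : ∀ j, EuclideanSpace ℂ (Fin (d₀ j)) →ₗ[ℂ] EuclideanSpace ℂ (Fin (d j))}
  {W : ∀ j, Submodule ℂ (EuclideanSpace ℂ (Fin (d₀ j)))}

/-- The invariant of a node of a protocol. The local operators along the branch from the root
compose to the maps `B j` and `P` is what remains of the protocol. The product vectors with all
their factors in the subspaces `W j`, on which `B j` is conformal, are still told apart, and the
other members of the family are orthogonal to `⨂ⱼ W j`. -/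
structure IsBranch (φ : ι → ∀ j, EuclideanSpace ℂ (Fin (d₀ j))) (P : LOCCProtocol ι d)
    (B : ∀ j, EuclideanSpace ℂ (Fin (d₀ j)) →ₗ[ℂ] EuclideanSpace ℂ (Fin (d j)))
    (W : ∀ j, Submodule ℂ (EuclideanSpace ℂ (Fin (d₀ j)))) : Prop where
  conformal : ∀ j, IsConformalOn (B j) (W j)
  split : IsSplitBy φ W
  announces : ∀ x, (∀ j, φ x j ∈ W j) →
    P.SurelyAnnounces (productVector fun j => B j (φ x j)) x

namespace IsBranch

theorem exists_inner_map_eq_zero {P : LOCCProtocol ι d} (h : IsBranch φ P B W) {x y : ι}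
    (hx : ∀ j, φ x j ∈ W j) (hy : ∀ j, φ y j ∈ W j) (hne : x ≠ y) :
    ∃ j, inner ℂ (B j (φ x j)) (B j (φ y j)) = 0 :=
  inner_productVector_eq_zero_iff.1 ((h.announces x hx).inner_eq_zero (h.announces y hy) hne)

theorem exists_inner_eq_zero {P : LOCCProtocol ι d} (h : IsBranch φ P B W) {x y : ι}
    (hx : ∀ j, φ x j ∈ W j) (hy : ∀ j, φ y j ∈ W j) (hne : x ≠ y) :
    ∃ j, inner ℂ (φ x j) (φ y j) = 0 :=
  (h.exists_inner_map_eq_zero hx hy hne).imp fun j =>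
    ((h.conformal j).inner_map_eq_zero_iff (hx j) (hy j)).1

theorem eq_of_announce {z : ι} (h : IsBranch φ (.announce z) B W) (hφ0 : ∀ x j, φ x j ≠ 0)
    {x : ι} (hx : ∀ j, φ x j ∈ W j) : x = z := by
  by_contra hne
  obtain ⟨j, hj⟩ := productVector_eq_zero_iff.1 ((h.announces x hx).eq_zero_of_ne hne)
  exact hφ0 x j (((h.conformal j).map_eq_zero_iff (hx j)).1 hj)

section Round

variable {i : Fin m} {k : ℕ} {e : Fin k → Fin m → ℕ}
  {A : ∀ (a : Fin k) (j : Fin m), Matrix (Fin (e a j)) (Fin (d j)) ℂ}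
  {povm : ∑ a, (A a i)ᴴ * A a i = 1} {isometry : ∀ a j, j ≠ i → (A a j)ᴴ * A a j = 1}
  {cont : ∀ a, LOCCProtocol ι (e a)}

theorem surelyAnnounces_next (h : IsBranch φ (.round i k e A povm isometry cont) B W) (a : Fin k)
    {x : ι} (hx : ∀ j, φ x j ∈ W j) :
    (cont a).SurelyAnnounces
      (productVector fun j => (Matrix.toEuclideanLin (A a j) ∘ₗ B j) (φ x j)) x := by
  have hnext := (h.announces x hx).next a
  rwa [applyLocal_productVector] at hnext

theorem gramOn_mem_span_singleton (h : IsBranch φ (.round i k e A povm isometry cont) B W)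
    (hφ : IsUnextendible ℂ φ) (hφ0 : ∀ x j, φ x j ≠ 0) (a : Fin k) {x : ι}
    (hx : ∀ j, φ x j ∈ W j) :
    (gramOn (Matrix.toEuclideanLin (A a i) ∘ₗ B i) (W i) ⟨φ x i, hx i⟩ : EuclideanSpace ℂ _) ∈
      Submodule.span ℂ {φ x i} := by
  refine hφ.mem_span_singleton_of_update h.split (hφ0 x) hx
    (fun y hyx hy => h.exists_inner_eq_zero hy hx hyx) (SetLike.coe_mem _) fun y hyx hy => ?_
  obtain ⟨j, hj⟩ := inner_productVector_eq_zero_iff.1 <|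
    (h.surelyAnnounces_next a hy).inner_eq_zero (h.surelyAnnounces_next a hx) hyx
  refine ⟨j, ?_⟩
  rcases eq_or_ne j i with rfl | hji
  · rw [Function.update_self]
    exact (inner_gramOn _ (W j) ⟨φ y j, hy j⟩ ⟨φ x j, hx j⟩).trans hj
  · have hconf := (h.conformal j).isometry_comp
      (inner_toEuclideanLin_of_isometry (isometry a j hji))
    rw [Function.update_of_ne hji]
    exact (hconf.inner_map_eq_zero_iff (hy j) (hx j)).1 hj

theorem next (h : IsBranch φ (.round i k e A povm isometry cont) B W)
    (hφ : IsUnextendible ℂ φ) (hφ0 : ∀ x j, φ x j ≠ 0) (a : Fin k) {μ : ℂ} (hμ : μ ≠ 0) :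
    IsBranch φ (cont a) (fun j => Matrix.toEuclideanLin (A a j) ∘ₗ B j)
      (Function.update W i (gramEigenspace (Matrix.toEuclideanLin (A a i) ∘ₗ B i) (W i) μ)) where
  conformal :=
    (Function.forall_update_iff W
      fun j V => IsConformalOn (Matrix.toEuclideanLin (A a j) ∘ₗ B j) V).2
      ⟨isConformalOn_gramEigenspace hμ, fun j hj =>
        (h.conformal j).isometry_comp (inner_toEuclideanLin_of_isometry (isometry a j hj))⟩
  split := h.split.update gramEigenspace_le fun _ hx =>
    mem_gramEigenspace_or_mem_orthogonal (hx i) (h.gramOn_mem_span_singleton hφ hφ0 a hx)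
  announces _ hx :=
    have hle : Function.update W i _ ≤ W := update_le_self_iff.2 gramEigenspace_le
    h.surelyAnnounces_next a fun j => hle j (hx j)

end Round

theorem productVector_mem_span {P : LOCCProtocol ι d} (h : IsBranch φ P B W)
    (hφ : IsUnextendible ℂ φ) (hφ0 : ∀ x j, φ x j ≠ 0)
    {u : ∀ j, EuclideanSpace ℂ (Fin (d₀ j))} (hu : ∀ j, u j ∈ W j) :
    productVector u ∈ Submodule.span ℂ (Set.range fun x => productVector (φ x)) := by
  induction P generalizing W u with
  | announce z =>
    simpa only [productVectorMultilinear_apply] using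
      hφ.map_mem_span_of_subsingleton (productVectorMultilinear d₀) hφ0 h.split
        (fun x hx => h.eq_of_announce hφ0 hx) hu
  | round i k e A povm isometry next ih =>
    set L := Submodule.span ℂ (Set.range fun x => productVector (φ x))
    have hW : W i ≤ L.comap ((productVectorMultilinear d₀).toLinearMap u i) :=
      le_of_forall_gramEigenspace_le (M := fun a => Matrix.toEuclideanLin (A a i))
        (sum_inner_toEuclideanLin_of_povm povm) (h.conformal i) fun a μ hμ v hv => by
          refine ih a (h.next hφ hφ0 a hμ) fun j => ?_
          rcases eq_or_ne j i with rfl | hj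
          · rwa [Function.update_self, Function.update_self]
          · rw [Function.update_of_ne hj, Function.update_of_ne hj]
            exact hu j
    have hmem : productVector (Function.update u i (u i)) ∈ L := hW (hu i)
    rwa [Function.update_eq_self] at hmem

end IsBranch

theorem IsUnextendible.span_range_productVector_eq_top {P : LOCCProtocol ι d₀}
    (hφ : IsUnextendible ℂ φ) (hφ0 : ∀ x j, φ x j ≠ 0)
    (hP : ∀ x, P.SurelyAnnounces (productVector (φ x)) x) :
    Submodule.span ℂ (Set.range fun x => productVector (φ x)) = ⊤ := by
  have hroot : IsBranch φ P (fun _ => LinearMap.id) (fun _ => ⊤) :=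
    { conformal := fun _ => isConformalOn_id _
      split := fun _ => Or.inl fun _ => Submodule.mem_top
      announces := fun x _ => hP x }
  rw [eq_top_iff, ← span_range_productVector, Submodule.span_le]
  rintro _ ⟨u, rfl⟩
  exact hroot.productVector_mem_span hφ hφ0 fun _ => Submodule.mem_top

end Branches

theorem theorem2_general {m : ℕ} (d : Fin m → ℕ) (S : Set (MultipartiteSpace d))
    (hprod : ∀ ψ ∈ S, IsProductState ψ)
    (hunext : ∀ v ∈ (Submodule.span ℂ S)ᗮ, ¬ IsProductState v) (hS : LOCCDistinguishable S) :
    Submodule.span ℂ S = ⊤ := by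
  obtain ⟨P, hP⟩ := hS
  choose φ hnorm hφ using fun ψ : S => hprod ψ ψ.2
  have hrange : Set.range (fun ψ => productVector (φ ψ)) = S := by
    simp_rw [← hφ, Subtype.range_coe]
  have hφ0 : ∀ ψ j, φ ψ j ≠ 0 := fun ψ j => norm_ne_zero_iff.1 (by simp [hnorm ψ j])
  have hsure : ∀ ψ : S, P.SurelyAnnounces (productVector (φ ψ)) ψ := fun ψ => by
    rw [← hφ, LOCCProtocol.SurelyAnnounces, hP, (hprod ψ ψ.2).norm_eq_one, one_pow]
  have hφ_unext : IsUnextendible ℂ φ :=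
    isUnextendible_of_forall_not_isProductState (by rwa [hrange])
  rw [← hrange]
  exact hφ_unext.span_range_productVector_eq_top hφ0 hsure

theorem theorem2 {m : ℕ} (d : Fin m → ℕ) (S : Set (MultipartiteSpace d)) (hS : IsUPB S) :
    ¬ LOCCDistinguishable S :=
  fun h => hS.proper (theorem2_general d S hS.productState hS.unextendible h)
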